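/- Let $\mathbb{T}\subseteq\mathbb{R}$ be a time scale (a nonempty closed set), $a,b\in\mathbb{T}$ with $a<b$, $J=[a,b]\cap\mathbb{T}$, $N\in\mathbb{N}$, $0<\alpha\le 1$ and $1<p<\infty$, $\frac1p+\frac1{p'}=1$. Let $\sigma$ be the forward jump operator, $f^\Delta$ the delta derivative on $J$, $L^p_\Delta=L^p_\Delta([a,b)\cap\mathbb{T},\mathbb{R}^N)$ the Lebesgue space of the Lebesgue delta-measure (for which $[c,d)\cap\mathbb{T}$ has measure $d-c$ for all $c\le d$ in $J$), and $\int_a^b f(t)\,\Delta t$ the integral over $[a,b)\cap\mathbb{T}$ with respect to it. For $\varphi:J\to\mathbb{R}^N$ let $${}_a^{\mathbb{T}}I_t^{\beta}\varphi(t)=\frac1{\Gamma(\beta)}\int_a^t (t-\sigma(s))^{\beta-1}\varphi(s)\,\Delta s\quad(0<\beta<1),\qquad {}_a^{\mathbb{T}}I_t^{0}\varphi=\varphi,\qquad {}_a^{\mathbb{T}}D_t^{\alpha}\varphi=\big({}_a^{\mathbb{T}}I_t^{1-\alpha}\varphi\big)^{\Delta},$$ where for $\beta<1$ the kernel $(t-\sigma(s))^{\beta-1}$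 is read as $0$ if $\sigma(s)=t$. Let $C^\infty_{c,rd}$ be the set of all infinitely often delta differentiable $\varphi:J\to\mathbb{R}^N$ whose delta derivatives of all orders are rd-continuous and which vanish outside a compact subset of $(a,b)\cap\mathbb{T}$. For $u,g\in L^p_\Delta$ call $g$ a weak right derivative of order $\alpha$ of $u$ if $$\int_a^b u(t)\cdot{}_a^{\mathbb{T}}D_t^{\alpha}\varphi(t)\,\Delta t=\int_a^b g(t)\cdot\varphi(t)\,\Delta t$$ for all $\varphi\in C^\infty_{c,rd}$ for which ${}_a^{\mathbb{T}}I_t^{1-\alpha}\varphi$ exists on $J$ and ${}_a^{\mathbb{T}}D_t^{\alpha}\varphi$ exists $\Delta$-almost everywhere and belongs to $L^{p'}_\Delta$ (so that the left-hand side is defined). Let $W^{\alpha,p}_{\Delta,b^-}$ be the vector space of all $u\in L^p_\Delta$ that have a weak right derivative ${}_t^{\mathbb{T}}D_b^{\alpha}u\in L^p_\Delta$, with the norm $$\|u\|_{W^{\alpha,p}_{\Delta,b^-}}=\Big(\|u\|^p_{L^p_\Delta}+\|{}_t^{\mathbb{T}}D_b^{\alpha}u\|^p_{L^p_\Delta}\Big)^{1/p};$$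 if the weak right derivative of $u$ is not unique, the infimum of this expression over all weak right derivatives of $u$ is meant. Then the normed space $W^{\alpha,p}_{\Delta,b^-}$ is reflexive. -/

import Mathlib

open Set Filter Topology MeasureTheory
open scoped ENNReal

noncomputable section

namespace TimeScale

/-! A time scale is a nonempty closed subset of the real line; here `T : TopologicalSpace.Closeds ℝ`
together with points `a b : T`.  Functions on subsets of a time scale are represented by functions
on `ℝ` of which only the values on that subset matter. -/

/-- Forward jump operator `σ(t) = inf {s ∈ S : s > t}`, with `σ(t) = t` if there is no such `s`. -/
def sigma (S : Set ℝ) (t : ℝ) : ℝ :=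
  open Classical in if (S ∩ Ioi t).Nonempty then sInf (S ∩ Ioi t) else t

/-- Backward jump operator `ρ(t) = sup {s ∈ S : s < t}`, with `ρ(t) = t` if there is no such `s`. -/
def rho (S : Set ℝ) (t : ℝ) : ℝ :=
  open Classical in if (S ∩ Iio t).Nonempty then sSup (S ∩ Iio t) else t

/-- `S` with its maximum removed if that maximum is left-scattered. -/
def kappa (S : Set ℝ) : Set ℝ := {t ∈ S | ¬ (IsGreatest S t ∧ rho S t < t)}

/-- The interval `[a, b] ∩ T` of the time scale. -/
def seg (T : TopologicalSpace.Closeds ℝ) (a b : T) : Set ℝ := (T : Set ℝ) ∩ Icc (a : ℝ) b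

/-- `f` has delta (Hilger) derivative `f'` at `t`, relative to the time scale `S`. -/
def HasDeltaDerivAt {E : Type*} [NormedAddCommGroup E] [NormedSpace ℝ E]
    (S : Set ℝ) (f : ℝ → E) (f' : E) (t : ℝ) : Prop :=
  ∀ ε > (0 : ℝ), ∃ δ > (0 : ℝ), ∀ s ∈ S, |s - t| < δ →
    ‖f (sigma S t) - f s - (sigma S t - s) • f'‖ ≤ ε * |sigma S t - s|

/-- rd-continuity on `S`: continuous at right-dense points, finite left limits at left-dense
points. -/
def RdContinuousOn {E : Type*} [TopologicalSpace E] (S : Set ℝ) (f : ℝ → E) : Prop :=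
  (∀ t ∈ S, (∃ s ∈ S, t < s) → sigma S t = t → ContinuousWithinAt f S t) ∧
  (∀ t ∈ S, (∃ s ∈ S, s < t) → rho S t = t → ∃ l : E, Tendsto f (𝓝[S ∩ Iio t] t) (𝓝 l))

/-- The Lebesgue delta-measure of `[a, b) ∩ T`: the image of Lebesgue measure on `[a, b)` under the
map that sends `s` to the last point of `T` which is at most `s`.  It gives `[c, d) ∩ T` the mass
`d - c` for all points `c ≤ d` of `[a, b] ∩ T`; see `deltaMeasure_Ico`. -/
def deltaMeasure (T : TopologicalSpace.Closeds ℝ) (a b : T) : Measure ℝ :=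
  (volume.restrict (Ico (a : ℝ) b)).map (fun s => sSup ((T : Set ℝ) ∩ Iic s))

/-- Test functions: infinitely delta-differentiable on `[a, b] ∩ T`, all derivatives
rd-continuous, with compact support in `(a, b) ∩ T`.  The `n`-th derivative lives on the set
obtained from `[a, b] ∩ T` by applying `kappa` `n` times. -/
def IsTest {E : Type*} [NormedAddCommGroup E] [NormedSpace ℝ E]
    (T : TopologicalSpace.Closeds ℝ) (a b : T) (φ : ℝ → E) : Prop :=
  (∃ d : ℕ → ℝ → E, (∀ t ∈ seg T a b, d 0 t = φ t) ∧
    ∀ n, RdContinuousOn (kappa^[n] (seg T a b)) (d n) ∧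
      ∀ t ∈ kappa^[n + 1] (seg T a b),
        HasDeltaDerivAt (kappa^[n] (seg T a b)) (d n) (d (n + 1) t) t) ∧
  ∃ K : Set ℝ, IsCompact K ∧ K ⊆ (T : Set ℝ) ∩ Ioo (a : ℝ) b ∧ ∀ t ∈ seg T a b, t ∉ K → φ t = 0

/-- Integrand `s ↦ (t - σ(s)) ^ (β - 1) h(s)` of the left fractional integral, for `s < t`.
If `β < 1`, the value of the singular kernel at a point `s` with `σ(s) = t` is `0`, by the
convention `0 ^ x = 0` for `x < 0`. -/
def leftFracIntegrand {E : Type*} [NormedAddCommGroup E] [NormedSpace ℝ E]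
    (T : TopologicalSpace.Closeds ℝ) (a b : T) (β : ℝ) (h : ℝ → E) (t s : ℝ) : E :=
  (t - sigma (seg T a b) s) ^ (β - 1) • h s

/-- Left Riemann-Liouville fractional integral of order `β ≥ 0` from `a` to `t`; the identity if
`β = 0`. -/
def leftFracIntegral {E : Type*} [NormedAddCommGroup E] [NormedSpace ℝ E]
    (T : TopologicalSpace.Closeds ℝ) (a b : T) (β : ℝ) (h : ℝ → E) (t : ℝ) : E :=
  open Classical in
  if β = 0 then h t
  else (Real.Gamma β)⁻¹ • ∫ s in Ico (a : ℝ) t, leftFracIntegrand T a b β h t s ∂deltaMeasure T a b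

/-- `h` is the left Riemann-Liouville derivative of order `α` of `φ`: the fractional integral of
order `1 - α` of `φ` exists on `[a, b] ∩ T`, and its delta derivative is `h` almost everywhere. -/
def IsLeftRLDeriv {E : Type*} [NormedAddCommGroup E] [NormedSpace ℝ E]
    (T : TopologicalSpace.Closeds ℝ) (a b : T) (α : ℝ) (φ h : ℝ → E) : Prop :=
  (α ≠ 1 → ∀ t ∈ seg T a b,
    IntegrableOn (leftFracIntegrand T a b (1 - α) φ t) (Ico (a : ℝ) t) (deltaMeasure T a b)) ∧
  ∀ᵐ t ∂deltaMeasure T a b,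
    HasDeltaDerivAt (seg T a b) (leftFracIntegral T a b (1 - α) φ) (h t) t

/-- The space `L^p` of the delta-measure on `[a, b) ∩ T` with values in `ℝ^N` (Euclidean norm). -/
abbrev DeltaLp (T : TopologicalSpace.Closeds ℝ) (a b : T) (N : ℕ) (p : ℝ) : Type :=
  Lp (EuclideanSpace ℝ (Fin N)) (ENNReal.ofReal p) (deltaMeasure T a b)

/-- `g` is a weak right derivative of order `α` of `u`: one has `∫ u · D^α φ = ∫ g · φ` for all
test functions `φ` whose left Riemann-Liouville derivative `D^α φ = h` exists almost everywhere and
lies in the dual exponent space, so that the left-hand side is defined for every `u` in `L^p`. -/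
def IsWeakRightDeriv {T : TopologicalSpace.Closeds ℝ} {a b : T} {N : ℕ} {p : ℝ} (α : ℝ)
    (u g : DeltaLp T a b N p) : Prop :=
  ∀ φ h : ℝ → EuclideanSpace ℝ (Fin N), IsTest T a b φ → IsLeftRLDeriv T a b α φ h →
    MemLp h (ENNReal.conjExponent (ENNReal.ofReal p)) (deltaMeasure T a b) →
    ∫ t, inner ℝ (u t) (h t) ∂deltaMeasure T a b = ∫ t, inner ℝ (g t) (φ t) ∂deltaMeasure T a b

/-! ### Facts needed for the vector space structure -/

section Facts

variable {T : TopologicalSpace.Closeds ℝ} {a b : T}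

lemma proj_mem {s : ℝ} (hs : (a : ℝ) ≤ s) :
    sSup ((T : Set ℝ) ∩ Iic s) ∈ (T : Set ℝ) ∩ Iic s :=
  (T.isClosed.inter isClosed_Iic).csSup_mem ⟨a, a.2, hs⟩ ⟨s, fun _ hx => hx.2⟩

lemma le_proj_iff {s c : ℝ} (hs : (a : ℝ) ≤ s) (hc : c ∈ (T : Set ℝ)) :
    c ≤ sSup ((T : Set ℝ) ∩ Iic s) ↔ c ≤ s :=
  ⟨fun h => h.trans (proj_mem hs).2, fun h => le_csSup ⟨s, fun _ hx => hx.2⟩ ⟨hc, h⟩⟩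

lemma proj_aemeasurable : AEMeasurable (fun s => sSup ((T : Set ℝ) ∩ Iic s))
    (volume.restrict (Ico (a : ℝ) b)) := by
  refine aemeasurable_restrict_of_monotoneOn measurableSet_Ico fun x hx y hy hxy => ?_
  exact (le_proj_iff (a := a) hy.1 (proj_mem hx.1).1).2 ((proj_mem hx.1).2.trans hxy)

instance : IsFiniteMeasure (deltaMeasure T a b) := by
  unfold deltaMeasure; infer_instance

/-- The delta-measure of `[c, d) ∩ T` is `d - c`. -/
lemma deltaMeasure_Ico {c d : ℝ} (hc : c ∈ seg T a b) (hd : d ∈ seg T a b) :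
    deltaMeasure T a b (Ico c d) = ENNReal.ofReal (d - c) := by
  rw [deltaMeasure, Measure.map_apply_of_aemeasurable proj_aemeasurable measurableSet_Ico,
    Measure.restrict_apply₀' measurableSet_Ico.nullMeasurableSet, ← Real.volume_Ico]
  congr 1
  ext s
  simp only [mem_inter_iff, mem_preimage, mem_Ico]
  constructor
  · rintro ⟨⟨h1, h2⟩, h3, h4⟩
    exact ⟨(le_proj_iff (a := a) h3 hc.1).1 h1,
      lt_of_not_ge fun h => not_le.2 h2 ((le_proj_iff (a := a) h3 hd.1).2 h)⟩
  · rintro ⟨h1, h2⟩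
    have h3 : (a : ℝ) ≤ s := hc.2.1.trans h1
    exact ⟨⟨(le_proj_iff (a := a) h3 hc.1).2 h1,
      lt_of_not_ge fun h => not_le.2 h2 ((le_proj_iff (a := a) h3 hd.1).1 h)⟩,
      h3, h2.trans_le hd.2.2⟩

/-- The delta-measure is concentrated on `[a, b) ∩ T`. -/
lemma ae_mem : ∀ᵐ t ∂deltaMeasure T a b, t ∈ (T : Set ℝ) ∩ Ico (a : ℝ) b := by
  have hm : MeasurableSet {t : ℝ | t ∈ (T : Set ℝ) ∩ Ico (a : ℝ) b} :=
    T.isClosed.measurableSet.inter measurableSet_Ico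
  rw [deltaMeasure, ae_map_iff proj_aemeasurable hm]
  filter_upwards [ae_restrict_mem measurableSet_Ico] with s hs
  exact ⟨(proj_mem hs.1).1, (le_proj_iff (a := a) hs.1 a.2).2 hs.1, (proj_mem hs.1).2.trans_lt hs.2⟩

lemma HasDeltaDerivAt.continuousWithinAt {E : Type*} [NormedAddCommGroup E] [NormedSpace ℝ E]
    {S : Set ℝ} {f : ℝ → E} {f' : E} {t : ℝ} (ht : t ∈ S) (h : HasDeltaDerivAt S f f' t) :
    ContinuousWithinAt f S t := by
  set m := sigma S t with hm
  have h0 : f m - f t - (m - t) • f' = 0 := by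
    by_contra hne
    have hpos := norm_pos_iff.2 hne
    obtain ⟨δ, hδ, H⟩ := h (‖f m - f t - (m - t) • f'‖ / (2 * (|m - t| + 1))) (by positivity)
    have := H t ht (by simpa using hδ)
    rw [← hm, div_mul_eq_mul_div, le_div_iff₀ (by positivity)] at this
    nlinarith [abs_nonneg (m - t)]
  rw [Metric.continuousWithinAt_iff]
  intro ε hε
  have hC : 0 < |m - t| + 1 := by positivity
  obtain ⟨δ, hδ, H⟩ := h (ε / (2 * (|m - t| + 1))) (by positivity)
  refine ⟨min (min δ 1) (ε / (2 * (‖f'‖ + 1))), by positivity, fun s hs hst => ?_⟩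
  rw [Real.dist_eq, lt_min_iff, lt_min_iff] at hst
  obtain ⟨⟨h1, h2⟩, h3⟩ := hst
  have h4 := H s hs h1
  rw [← hm] at h4
  have h5 : f s - f t = -(f m - f s - (m - s) • f') + (f m - f t - (m - t) • f')
      + (s - t) • f' := by module
  have h6 : |m - s| ≤ |m - t| + 1 := by
    have := abs_sub_le m t s
    rw [abs_sub_comm t s] at this
    linarith
  have h7 : ε / (2 * (|m - t| + 1)) * |m - s| ≤ ε / 2 := by
    calc _ ≤ ε / (2 * (|m - t| + 1)) * (|m - t| + 1) := by gcongr
      _ = ε / 2 := by field_simp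
  have h8 : |s - t| * ‖f'‖ < ε / 2 := by
    rw [lt_div_iff₀ (by positivity)] at h3
    nlinarith [abs_nonneg (s - t), norm_nonneg f']
  rw [dist_eq_norm, h5, h0, add_zero]
  calc _ ≤ ‖-(f m - f s - (m - s) • f')‖ + ‖(s - t) • f'‖ := norm_add_le _ _
    _ < ε := by rw [norm_neg, norm_smul, Real.norm_eq_abs]; linarith

lemma IsTest.memLp {E : Type*} [NormedAddCommGroup E] [NormedSpace ℝ E] {φ : ℝ → E}
    (hφ : IsTest T a b φ) (q : ℝ≥0∞) : MemLp φ q (deltaMeasure T a b) := by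
  obtain ⟨⟨d, hd0, hd⟩, K, hK, hKs, hφK⟩ := hφ
  have hcont : ContinuousOn φ ((T : Set ℝ) ∩ Ico (a : ℝ) b) := by
    intro t ht
    have htJ : t ∈ seg T a b := ⟨ht.1, ht.2.1, ht.2.2.le⟩
    have htk : t ∈ kappa (seg T a b) :=
      ⟨htJ, fun h => not_lt.2 (h.1.2 (⟨b.2, ht.2.1.trans ht.2.2.le, le_rfl⟩ : (b : ℝ) ∈ seg T a b))
        ht.2.2⟩
    have := HasDeltaDerivAt.continuousWithinAt htJ ((hd 0).2 t htk)
    have h2 : ContinuousWithinAt φ (seg T a b) t :=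
      this.congr (fun y hy => (hd0 y hy).symm) (hd0 t htJ).symm
    exact h2.mono fun x hx => ⟨hx.1, hx.2.1, hx.2.2.le⟩
  have hmeas : AEStronglyMeasurable φ (deltaMeasure T a b) := by
    have h := hcont.aestronglyMeasurable (μ := deltaMeasure T a b)
      (T.isClosed.measurableSet.inter measurableSet_Ico)
    rwa [Measure.restrict_eq_self_of_ae_mem ae_mem] at h
  obtain ⟨C, hC⟩ := hK.exists_bound_of_continuousOn
    (hcont.mono fun x hx => ⟨(hKs hx).1, (hKs hx).2.1.le, (hKs hx).2.2⟩)
  refine MemLp.of_bound hmeas (max C 0) ?_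
  filter_upwards [ae_mem (T := T) (a := a) (b := b)] with t ht
  by_cases htK : t ∈ K
  · exact (hC t htK).trans (le_max_left _ _)
  · rw [hφK t ⟨ht.1, ht.2.1, ht.2.2.le⟩ htK]
    simp

variable {N : ℕ} {p : ℝ}

lemma integrable_pairing [hp : Fact (1 ≤ p)] (u : DeltaLp T a b N p)
    {h : ℝ → EuclideanSpace ℝ (Fin N)}
    (hh : MemLp h (ENNReal.conjExponent (ENNReal.ofReal p)) (deltaMeasure T a b)) :
    Integrable (fun t => inner ℝ (u t) (h t)) (deltaMeasure T a b) := by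
  have : ENNReal.HolderConjugate (ENNReal.ofReal p) (ENNReal.conjExponent (ENNReal.ofReal p)) :=
    ENNReal.HolderConjugate.conjExponent (by simpa using hp.out)
  rw [← memLp_one_iff_integrable]
  exact MemLp.of_bilin (r := 1) (fun x y => inner ℝ x y) 1 (Lp.memLp u) hh
    ((Lp.memLp u).1.inner hh.1)
    (Eventually.of_forall fun t => by
      rw [one_mul]
      exact nnnorm_inner_le_nnnorm (𝕜 := ℝ) (u t) (h t))

instance [hp : Fact (1 ≤ p)] : Fact ((1 : ℝ≥0∞) ≤ ENNReal.ofReal p) :=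
  ⟨by simpa using hp.out⟩

lemma IsWeakRightDeriv.zero (α : ℝ) : IsWeakRightDeriv α (0 : DeltaLp T a b N p) 0 := by
  intro φ h _ _ _
  have h0 : (fun t => ((0 : DeltaLp T a b N p) : ℝ → EuclideanSpace ℝ (Fin N)) t)
      =ᵐ[deltaMeasure T a b] 0 := Lp.coeFn_zero _ _ _
  rw [integral_eq_zero_of_ae (h0.mono fun t ht => by simp at ht; simp [ht]),
    integral_eq_zero_of_ae (h0.mono fun t ht => by simp at ht; simp [ht])]

lemma IsWeakRightDeriv.add [Fact (1 ≤ p)] {α : ℝ} {u g v k : DeltaLp T a b N p}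
    (h1 : IsWeakRightDeriv α u g) (h2 : IsWeakRightDeriv α v k) :
    IsWeakRightDeriv α (u + v) (g + k) := by
  intro φ h hφ hRL hh
  have key : ∀ (x y : DeltaLp T a b N p) (w : ℝ → EuclideanSpace ℝ (Fin N)),
      MemLp w (ENNReal.conjExponent (ENNReal.ofReal p)) (deltaMeasure T a b) →
      ∫ t, inner ℝ ((x + y) t) (w t) ∂deltaMeasure T a b =
        ∫ t, inner ℝ (x t) (w t) ∂deltaMeasure T a b +
          ∫ t, inner ℝ (y t) (w t) ∂deltaMeasure T a b := by
    intro x y w hw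
    rw [← integral_add (integrable_pairing x hw) (integrable_pairing y hw)]
    refine integral_congr_ae ?_
    filter_upwards [Lp.coeFn_add x y] with t ht
    rw [ht, Pi.add_apply, inner_add_left]
  rw [key u v h hh, key g k φ (hφ.memLp _), h1 φ h hφ hRL hh, h2 φ h hφ hRL hh]

lemma IsWeakRightDeriv.smul [Fact (1 ≤ p)] {α : ℝ} {u g : DeltaLp T a b N p} (c : ℝ)
    (h1 : IsWeakRightDeriv α u g) : IsWeakRightDeriv α (c • u) (c • g) := by
  intro φ h hφ hRL hh
  have key : ∀ (x : DeltaLp T a b N p) (w : ℝ → EuclideanSpace ℝ (Fin N)),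
      ∫ t, inner ℝ ((c • x) t) (w t) ∂deltaMeasure T a b =
        c * ∫ t, inner ℝ (x t) (w t) ∂deltaMeasure T a b := by
    intro x w
    rw [← integral_const_mul]
    refine integral_congr_ae ?_
    filter_upwards [Lp.coeFn_smul c x] with t ht
    rw [ht, Pi.smul_apply, real_inner_smul_left]
  rw [key u h, key g φ, h1 φ h hφ hRL hh]

end Facts

/-! ### The right fractional Sobolev space -/

/-- The right fractional Sobolev space as a linear subspace of `L^p`: all `u` in `L^p` that have a
weak right derivative of order `α` in `L^p`. -/
def sobolevSubmodule (T : TopologicalSpace.Closeds ℝ) (a b : T) (N : ℕ) (α p : ℝ)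
    [Fact (1 ≤ p)] : Submodule ℝ (DeltaLp T a b N p) where
  carrier := {u | ∃ g : DeltaLp T a b N p, IsWeakRightDeriv α u g}
  zero_mem' := ⟨0, IsWeakRightDeriv.zero α⟩
  add_mem' := fun ⟨g, hg⟩ ⟨k, hk⟩ => ⟨g + k, hg.add hk⟩
  smul_mem' := fun c _ ⟨g, hg⟩ => ⟨c • g, hg.smul c⟩

/-- The right fractional Sobolev space, as a type of its own, to carry its own norm. -/
def RightSobolev (T : TopologicalSpace.Closeds ℝ) (a b : T) (N : ℕ) (α p : ℝ)
    [Fact (1 ≤ p)] : Type :=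
  sobolevSubmodule T a b N α p

namespace RightSobolev

variable {T : TopologicalSpace.Closeds ℝ} {a b : T} {N : ℕ} {α p : ℝ} [Fact (1 ≤ p)]

instance : AddCommGroup (RightSobolev T a b N α p) :=
  inferInstanceAs (AddCommGroup (sobolevSubmodule T a b N α p))

instance : Module ℝ (RightSobolev T a b N α p) :=
  inferInstanceAs (Module ℝ (sobolevSubmodule T a b N α p))

/-- The underlying element of `L^p`. -/
def toLp (u : RightSobolev T a b N α p) : DeltaLp T a b N p := Subtype.val u

/-- The norm `(‖u‖^p + ‖D^α u‖^p)^(1/p)`.  If the weak right derivative `D^α u` is not unique, which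
happens for some time scales, the infimum over all weak right derivatives of `u` is meant. -/
instance : Norm (RightSobolev T a b N α p) where
  norm u := sInf {r : ℝ | ∃ g : DeltaLp T a b N p,
    IsWeakRightDeriv α u.toLp g ∧ r = (‖u.toLp‖ ^ p + ‖g‖ ^ p) ^ (1 / p)}

lemma norm_def (u : RightSobolev T a b N α p) : ‖u‖ = sInf {r : ℝ | ∃ g : DeltaLp T a b N p,
    IsWeakRightDeriv α u.toLp g ∧ r = (‖u.toLp‖ ^ p + ‖g‖ ^ p) ^ (1 / p)} := rfl

/-- If the weak right derivative is unique, the norm is given by the usual formula. -/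
lemma norm_eq_of_unique (u : RightSobolev T a b N α p) {g : DeltaLp T a b N p}
    (hg : IsWeakRightDeriv α u.toLp g) (huniq : ∀ k, IsWeakRightDeriv α u.toLp k → k = g) :
    ‖u‖ = (‖u.toLp‖ ^ p + ‖g‖ ^ p) ^ (1 / p) := by
  rw [norm_def]
  have : {r : ℝ | ∃ k : DeltaLp T a b N p,
      IsWeakRightDeriv α u.toLp k ∧ r = (‖u.toLp‖ ^ p + ‖k‖ ^ p) ^ (1 / p)} =
      {(‖u.toLp‖ ^ p + ‖g‖ ^ p) ^ (1 / p)} := by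
    ext r
    constructor
    · rintro ⟨k, hk, rfl⟩
      rw [huniq k hk]
      rfl
    · rintro rfl
      exact ⟨g, hg, rfl⟩
  rw [this, csInf_singleton]

lemma pair_norm (x y : DeltaLp T a b N p) :
    (‖x‖ ^ p + ‖y‖ ^ p) ^ (1 / p) = ‖WithLp.toLp (ENNReal.ofReal p) (x, y)‖ := by
  have hp : 0 < p := lt_of_lt_of_le one_pos (Fact.out : 1 ≤ p)
  have hp' : (ENNReal.ofReal p).toReal = p := ENNReal.toReal_ofReal hp.le
  rw [WithLp.prod_norm_eq_add (by rw [hp']; exact hp), hp']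
  rfl

lemma norm_le (u : RightSobolev T a b N α p) {g : DeltaLp T a b N p}
    (hg : IsWeakRightDeriv α u.toLp g) : ‖u‖ ≤ ‖WithLp.toLp (ENNReal.ofReal p) (u.toLp, g)‖ := by
  rw [← pair_norm]
  refine csInf_le ⟨0, ?_⟩ ⟨g, hg, rfl⟩
  rintro _ ⟨k, _, rfl⟩
  positivity

lemma le_norm (u : RightSobolev T a b N α p) {c : ℝ}
    (h : ∀ g : DeltaLp T a b N p, IsWeakRightDeriv α u.toLp g →
      c ≤ ‖WithLp.toLp (ENNReal.ofReal p) (u.toLp, g)‖) : c ≤ ‖u‖ := by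
  obtain ⟨g, hg⟩ := u.2
  refine le_csInf ⟨_, g, hg, rfl⟩ ?_
  rintro _ ⟨k, hk, rfl⟩
  rw [pair_norm]
  exact h k hk

lemma norm_toLp_le (u : RightSobolev T a b N α p) : ‖u.toLp‖ ≤ ‖u‖ :=
  le_norm u fun g _ => by
    exact WithLp.norm_fst_le _ (WithLp.toLp (ENNReal.ofReal p) (u.toLp, g))

lemma norm_smul_le_aux (c : ℝ) (u : RightSobolev T a b N α p) : ‖c • u‖ ≤ |c| * ‖u‖ := by
  rcases eq_or_ne c 0 with rfl | hc
  · have h0 : IsWeakRightDeriv α ((0 : ℝ) • u).toLp (0 : DeltaLp T a b N p) := by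
      rw [zero_smul]
      exact IsWeakRightDeriv.zero α
    refine (norm_le _ h0).trans ?_
    rw [zero_smul]
    change ‖WithLp.toLp (ENNReal.ofReal p) ((0 : DeltaLp T a b N p), (0 : DeltaLp T a b N p))‖ ≤ _
    rw [show ((0 : DeltaLp T a b N p), (0 : DeltaLp T a b N p)) = 0 from rfl, WithLp.toLp_zero]
    simp
  · rw [← div_le_iff₀' (abs_pos.2 hc)]
    refine le_norm u fun g hg => ?_
    rw [div_le_iff₀' (abs_pos.2 hc)]
    refine (norm_le (c • u) (hg.smul c)).trans (le_of_eq ?_)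
    rw [← Real.norm_eq_abs, ← norm_smul]
    rfl

lemma core : NormedSpace.Core ℝ (RightSobolev T a b N α p) where
  norm_nonneg u := (norm_nonneg (toLp _)).trans (norm_toLp_le u)
  norm_smul c u := by
    refine le_antisymm (norm_smul_le_aux c u) ?_
    rcases eq_or_ne c 0 with rfl | hc
    · simpa using (norm_nonneg (toLp _)).trans (norm_toLp_le ((0 : ℝ) • u))
    · have := norm_smul_le_aux c⁻¹ (c • u)
      rw [smul_smul, inv_mul_cancel₀ hc, one_smul, abs_inv] at this
      rwa [Real.norm_eq_abs, ← le_inv_mul_iff₀ (abs_pos.2 hc)]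
  norm_triangle u v := by
    rw [← sub_le_iff_le_add]
    refine le_norm u fun g hg => ?_
    rw [sub_le_comm]
    refine le_norm v fun k hk => ?_
    rw [sub_le_iff_le_add']
    exact (norm_le (u + v) (hg.add hk)).trans
      (norm_add_le (WithLp.toLp (ENNReal.ofReal p) (u.toLp, g)) (WithLp.toLp _ (v.toLp, k)))
  norm_eq_zero_iff u := by
    constructor
    · intro h
      have := norm_toLp_le u
      rw [h, norm_le_zero_iff] at this
      exact Subtype.ext this
    · rintro rfl
      refine le_antisymm ?_ ((norm_nonneg _).trans
        (norm_toLp_le (0 : RightSobolev T a b N α p)))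
      simpa using norm_smul_le_aux 0 (0 : RightSobolev T a b N α p)

instance : NormedAddCommGroup (RightSobolev T a b N α p) := NormedAddCommGroup.ofCore core

instance : NormedSpace ℝ (RightSobolev T a b N α p) := NormedSpace.ofCore core

end RightSobolev

/-- A normed space is reflexive if the canonical map into its bidual is onto. -/
def IsReflexive (X : Type*) [NormedAddCommGroup X] [NormedSpace ℝ X] : Prop :=
  Function.Surjective (NormedSpace.inclusionInDoubleDual ℝ X)

end TimeScale

end

namespace TimeScale

/-! ### Stability of reflexivity under images, closed subspaces and finite products -/

section Reflexive

variable {X Y : Type*} [NormedAddCommGroup X] [NormedSpace ℝ X]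
  [NormedAddCommGroup Y] [NormedSpace ℝ Y]

/-! The properties of the fractional operators play almost no role. Every admissible test function
imposes one linear condition on a pair `(u, g)`, and Hölder's inequality makes both sides of it
continuous in the pair. Hence the graph of all pairs is a closed subspace of `L^p × L^p`
(`isClosed_weakDerivGraph`). The Sobolev norm is the infimum of the `ℓ^p` norm of `(u, g)` over all
weak derivatives `g` of `u`, so, up to an equivalent norm, the Sobolev space is the quotient of this
graph by the pairs `(0, g)` in it. Reflexivity passes to products, closed subspaces and such
quotients (`IsReflexive.prod`, `IsReflexive.submodule`, `IsReflexive.of_surjective`), which leaves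
the reflexivity of `L^p`.

For real-valued functions on a finite measure space this follows from the Riesz representation of
functionals on `L^p` (`scalarPairing_surjective`), applied to both conjugate exponents. The density
comes from Radon-Nikodym, and truncation together with the extremal function of Hölder's inequality
puts it in `L^q`. Vector values are treated coordinatewise. -/

lemma isReflexive_iff : IsReflexive X ↔
    ∀ L : StrongDual ℝ (StrongDual ℝ X), ∃ x : X, ∀ f : StrongDual ℝ X, L f = f x :=
  forall_congr' fun L => exists_congr fun x =>
    ⟨fun h f => by rw [← h]; rfl, fun h => by ext f; exact (h f).symm⟩

/-- The image of a reflexive space under a bounded operator that is onto, with preimages of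
controlled norm, is reflexive. -/
lemma IsReflexive.of_surjective (hY : IsReflexive Y) (P : Y →L[ℝ] X) (C : ℝ)
    (hP : ∀ x, ∃ y, P y = x ∧ ‖y‖ ≤ C * ‖x‖) : IsReflexive X := by
  rw [isReflexive_iff] at hY ⊢
  intro L
  -- The adjoint of `P` is bounded below because preimages have controlled norm. So `L` can be
  -- transported to its range, extended to the dual of `Y` by Hahn-Banach, and represented there by
  -- some `y`; then `P y` represents `L`.
  let A : StrongDual ℝ X →L[ℝ] StrongDual ℝ Y := P.precomp ℝ
  have hA : ∀ f, ‖f‖ ≤ |C| * ‖A f‖ := fun f => by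
    refine f.opNorm_le_bound (by positivity) fun x => ?_
    obtain ⟨y, rfl, hy⟩ := hP x
    calc ‖f (P y)‖ = ‖A f y‖ := rfl
      _ ≤ ‖A f‖ * ‖y‖ := (A f).le_opNorm y
      _ ≤ ‖A f‖ * (|C| * ‖P y‖) := by
        gcongr
        exact hy.trans (by gcongr; exact le_abs_self C)
      _ = |C| * ‖A f‖ * ‖P y‖ := by ring
  have hinj : Function.Injective A.toLinearMap := by
    refine (injective_iff_map_eq_zero _).2 fun f hf => ?_
    have := hA f
    rw [show A f = 0 from hf, norm_zero, mul_zero] at this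
    exact norm_le_zero_iff.1 this
  let e := LinearEquiv.ofInjective A.toLinearMap hinj
  have he : ∀ z, A (e.symm z) = z := fun z => by
    conv_rhs => rw [← e.apply_symm_apply z]
    rfl
  have hl : ∀ z : LinearMap.range A.toLinearMap, ‖L (e.symm z)‖ ≤ ‖L‖ * |C| * ‖z‖ := fun z => by
    refine (L.le_opNorm (e.symm z)).trans ?_
    rw [mul_assoc]
    gcongr
    exact (hA _).trans (by rw [he]; rfl)
  let l : StrongDual ℝ (LinearMap.range A.toLinearMap) :=
    LinearMap.mkContinuous
      { toFun := fun z => L (e.symm z)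
        map_add' := fun z w => by rw [map_add, map_add]
        map_smul' := fun c z => by rw [map_smul, map_smul]; rfl } (‖L‖ * |C|) hl
  obtain ⟨M, hM, -⟩ := exists_extension_norm_eq _ l
  obtain ⟨y, hy⟩ := hY M
  refine ⟨P y, fun f => ?_⟩
  have h1 : l (e f) = L f := by
    change L (e.symm (e f)) = L f
    rw [e.symm_apply_apply]
  rw [← h1, ← hM, hy]
  rfl

/-- Composing `L` with restriction of functionals to `G` gives an element of the bidual of `Y`,
hence a point `y`. Functionals vanishing on `G` vanish at `y`, so `y` lies in the closed subspace
`G`; Hahn-Banach extension then shows that `y` represents `L`. -/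
lemma IsReflexive.submodule (hY : IsReflexive Y) (G : Submodule ℝ Y) (hG : IsClosed (G : Set Y)) :
    IsReflexive G := by
  rw [isReflexive_iff] at hY ⊢
  intro L
  obtain ⟨y, hy⟩ := hY (L ∘L G.subtypeL.precomp ℝ)
  have hyG : y ∈ G := by
    by_contra hn
    obtain ⟨f, u, hfu, huf⟩ := geometric_hahn_banach_point_closed G.convex hG hn
    have h0 : ∀ g ∈ G, f g = 0 := by
      intro g hg
      by_contra hne
      -- This multiple of `g` has `f`-value `u - 1`, although `f` exceeds `u` on all of `G`.
      have := huf (((u - 1) / f g) • g) (G.smul_mem _ hg)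
      rw [map_smul, smul_eq_mul, div_mul_cancel₀ _ hne] at this
      linarith
    have h1 : G.subtypeL.precomp ℝ f = 0 := by
      ext g
      exact h0 g g.2
    have h2 := hy f
    rw [ContinuousLinearMap.comp_apply, h1, map_zero] at h2
    have := huf 0 G.zero_mem
    rw [map_zero] at this
    linarith
  refine ⟨⟨y, hyG⟩, fun g => ?_⟩
  obtain ⟨f, hf, -⟩ := exists_extension_norm_eq G g
  have h1 : G.subtypeL.precomp ℝ f = g := by
    ext z
    exact hf z
  have h2 := hy f
  rw [ContinuousLinearMap.comp_apply, h1] at h2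
  rw [h2, ← hf]

lemma IsReflexive.prod (hX : IsReflexive X) (hY : IsReflexive Y) : IsReflexive (X × Y) := by
  rw [isReflexive_iff] at hX hY ⊢
  intro L
  obtain ⟨x, hx⟩ := hX (L ∘L (ContinuousLinearMap.fst ℝ X Y).precomp ℝ)
  obtain ⟨y, hy⟩ := hY (L ∘L (ContinuousLinearMap.snd ℝ X Y).precomp ℝ)
  refine ⟨(x, y), fun f => ?_⟩
  have h1 := hx (f ∘L ContinuousLinearMap.inl ℝ X Y)
  have h2 := hy (f ∘L ContinuousLinearMap.inr ℝ X Y)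
  have h3 : f = (f ∘L ContinuousLinearMap.inl ℝ X Y) ∘L ContinuousLinearMap.fst ℝ X Y +
      (f ∘L ContinuousLinearMap.inr ℝ X Y) ∘L ContinuousLinearMap.snd ℝ X Y := by
    ext <;> simp [show f (0, 0) = 0 from map_zero f]
  conv_lhs => rw [h3, map_add]
  refine (congrArg₂ (· + ·) h1 h2).trans ?_
  simp [← map_add]

lemma IsReflexive.pi {ι : Type*} [Fintype ι] (hX : IsReflexive X) : IsReflexive (ι → X) := by
  classical
  rw [isReflexive_iff] at hX ⊢
  intro L
  choose x hx using fun i =>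
    hX (L ∘L (ContinuousLinearMap.proj (R := ℝ) (φ := fun _ : ι => X) i).precomp ℝ)
  refine ⟨x, fun f => ?_⟩
  have h3 : f = ∑ i, (f ∘L ContinuousLinearMap.single ℝ (fun _ : ι => X) i) ∘L
      ContinuousLinearMap.proj i := by
    ext v
    simp only [_root_.sum_apply, ContinuousLinearMap.comp_apply,
      ContinuousLinearMap.proj_apply, ContinuousLinearMap.single_apply]
    rw [← map_sum, Finset.univ_sum_single]
  conv_lhs => rw [h3, map_sum]
  conv_rhs => rw [h3]
  rw [_root_.sum_apply]
  exact Finset.sum_congr rfl fun i _ =>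
    hx i (f ∘L ContinuousLinearMap.single ℝ (fun _ : ι => X) i)

end Reflexive

/-! ### The closed graph of the weak derivative and its projection -/

section Graph

variable {T : TopologicalSpace.Closeds ℝ} {a b : T} {N : ℕ} {α p : ℝ} [Fact (1 ≤ p)]

lemma continuous_pairing {h : ℝ → EuclideanSpace ℝ (Fin N)}
    (hh : MemLp h (ENNReal.conjExponent (ENNReal.ofReal p)) (deltaMeasure T a b)) :
    Continuous fun u : DeltaLp T a b N p => ∫ t, inner ℝ (u t) (h t) ∂deltaMeasure T a b := by
  have hc : ENNReal.HolderConjugate (ENNReal.ofReal p) (ENNReal.conjExponent (ENNReal.ofReal p)) :=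
    ENNReal.HolderConjugate.conjExponent Fact.out
  have : Fact (1 ≤ ENNReal.conjExponent (ENNReal.ofReal p)) := ⟨hc.symm.one_le⟩
  have key : (fun u : DeltaLp T a b N p => ∫ t, inner ℝ (u t) (h t) ∂deltaMeasure T a b) =
      fun u => (innerSL ℝ).lpPairing (deltaMeasure T a b) (ENNReal.ofReal p)
        (ENNReal.conjExponent (ENNReal.ofReal p)) u hh.toLp := by
    ext u
    rw [ContinuousLinearMap.lpPairing_eq_integral]
    refine integral_congr_ae ?_
    filter_upwards [hh.coeFn_toLp] with t ht
    rw [ht, innerSL_apply_apply]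
  rw [key]
  fun_prop

variable (T a b N α p) in
/-- The graph of the weak right derivative, a possibly multivalued operator on `L^p`. -/
def weakDerivGraph : Submodule ℝ (DeltaLp T a b N p × DeltaLp T a b N p) where
  carrier := {z | IsWeakRightDeriv α z.1 z.2}
  zero_mem' := IsWeakRightDeriv.zero α
  add_mem' := fun h k => IsWeakRightDeriv.add h k
  smul_mem' := fun c _ h => IsWeakRightDeriv.smul c h

lemma isClosed_weakDerivGraph :
    IsClosed (weakDerivGraph T a b N α p : Set (DeltaLp T a b N p × DeltaLp T a b N p)) := by
  change IsClosed {z : DeltaLp T a b N p × DeltaLp T a b N p | IsWeakRightDeriv α z.1 z.2}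
  simp only [IsWeakRightDeriv, ofPred_forall]
  refine isClosed_iInter fun φ => isClosed_iInter fun h => isClosed_iInter fun hφ =>
    isClosed_iInter fun _ => isClosed_iInter fun hh => ?_
  exact isClosed_eq ((continuous_pairing hh).comp continuous_fst)
    ((continuous_pairing (hφ.memLp _)).comp continuous_snd)

variable (T a b N α p) in
/-- The projection of the graph of the weak right derivative onto the Sobolev space. -/
noncomputable def graphProj : weakDerivGraph T a b N α p →L[ℝ] RightSobolev T a b N α p :=
  LinearMap.mkContinuous
    { toFun := fun z => (⟨z.1.1, z.1.2, z.2⟩ : sobolevSubmodule T a b N α p)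
      map_add' := fun _ _ => rfl
      map_smul' := fun _ _ => rfl } 2 fun z => by
    refine (RightSobolev.norm_le (α := α)
      (show RightSobolev T a b N α p from ⟨z.1.1, z.1.2, z.2⟩) (g := z.1.2) z.2).trans ?_
    change ‖WithLp.toLp (ENNReal.ofReal p) (z.1.1, z.1.2)‖ ≤ _
    -- The graph carries the maximum norm of the product. The `ℓ^p` norm of a pair is at most the
    -- sum of the two norms, hence at most twice their maximum.
    have h1 : (z.1.1, z.1.2) = (z.1.1, (0 : DeltaLp T a b N p)) + (0, z.1.2) := by simp
    rw [h1, WithLp.toLp_add]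
    refine (norm_add_le _ _).trans ?_
    rw [WithLp.norm_toLp_fst, WithLp.norm_toLp_snd, two_mul]
    exact add_le_add (norm_fst_le z.1) (norm_snd_le z.1)

/-- The infimum defining the norm need not be known to be attained: for `x ≠ 0` some weak derivative
comes within a factor `2` of it, and the maximum norm is at most the `ℓ^p` norm. -/
lemma exists_graphProj_eq (x : RightSobolev T a b N α p) :
    ∃ z, graphProj T a b N α p z = x ∧ ‖z‖ ≤ 2 * ‖x‖ := by
  rcases eq_or_ne x 0 with rfl | hx
  · exact ⟨0, map_zero _, by simp⟩
  · have hlt : ‖x‖ < 2 * ‖x‖ := by linarith [norm_pos_iff.2 hx]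
    obtain ⟨g, hg, hgx⟩ : ∃ g : DeltaLp T a b N p, IsWeakRightDeriv α x.toLp g ∧
        ‖WithLp.toLp (ENNReal.ofReal p) (x.toLp, g)‖ < 2 * ‖x‖ := by
      by_contra! hn
      exact not_le.2 hlt (RightSobolev.le_norm x hn)
    refine ⟨⟨(x.toLp, g), hg⟩, rfl, le_trans ?_ hgx.le⟩
    exact max_le (WithLp.norm_fst_le _ (WithLp.toLp (ENNReal.ofReal p) (x.toLp, g)))
      (WithLp.norm_snd_le _ (WithLp.toLp (ENNReal.ofReal p) (x.toLp, g)))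

lemma isReflexive_rightSobolev (h : IsReflexive (DeltaLp T a b N p)) :
    IsReflexive (RightSobolev T a b N α p) :=
  ((h.prod h).submodule _ isClosed_weakDerivGraph).of_surjective (graphProj T a b N α p) 2
    exists_graphProj_eq

end Graph

/-! ### Riesz representation and reflexivity of `L^p` over a finite measure -/

section Riesz

variable {Ω : Type*} [MeasurableSpace Ω] {μ : Measure Ω} [IsFiniteMeasure μ]
  {p q : ℝ≥0∞} [Fact (1 ≤ p)] [Fact (1 ≤ q)]

/-- The integral pairing of scalar `L^q` and `L^p`. -/
noncomputable abbrev scalarPairing (μ : Measure Ω) (q p : ℝ≥0∞) [Fact (1 ≤ p)] [Fact (1 ≤ q)]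
    [ENNReal.HolderConjugate q p] : Lp ℝ q μ →L[ℝ] StrongDual ℝ (Lp ℝ p μ) :=
  (ContinuousLinearMap.mul ℝ ℝ).lpPairing μ q p

/-- The set function `E ↦ f (1_E)` induced by a functional on `L^p`, as a signed measure. -/
lemma exists_signedMeasure (hp : p ≠ ∞) (f : StrongDual ℝ (Lp ℝ p μ)) :
    ∃ ν : SignedMeasure Ω, ∀ (E : Set Ω) (hE : MeasurableSet E),
      ν E = f (indicatorConstLp p hE (measure_ne_top μ E) 1) := by
  classical
  let m : Set Ω → ℝ := fun E =>
    if hE : MeasurableSet E then f (indicatorConstLp p hE (measure_ne_top μ E) 1) else 0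
  have m_def : ∀ (E : Set Ω) (hE : MeasurableSet E),
      m E = f (indicatorConstLp p hE (measure_ne_top μ E) 1) := fun E hE => dif_pos hE
  have m_empty : m ∅ = 0 := by
    rw [m_def ∅ .empty, indicatorConstLp_empty, map_zero]
  have m_biUnion : ∀ F : ℕ → Set Ω, (∀ i, MeasurableSet (F i)) → Pairwise (Function.onFun Disjoint F) →
      ∀ s : Finset ℕ, m (⋃ i ∈ s, F i) = ∑ i ∈ s, m (F i) := by
    intro F hF hd s
    induction s using Finset.induction_on with
    | empty => simpa using m_empty
    | insert i s hi ih =>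
      have hm : MeasurableSet (⋃ j ∈ s, F j) := s.measurableSet_biUnion fun j _ => hF j
      have hdis : Disjoint (F i) (⋃ j ∈ s, F j) := by
        simp only [Set.disjoint_iUnion_right]
        exact fun j hj => hd (ne_of_mem_of_not_mem hj hi).symm
      rw [Finset.sum_insert hi, ← ih, Finset.set_biUnion_insert, m_def _ ((hF i).union hm),
        indicatorConstLp_disjoint_union (hF i) hm (measure_ne_top _ _) (measure_ne_top _ _) hdis,
        map_add, m_def _ (hF i), m_def _ hm]
  refine ⟨⟨m, m_empty, fun E hE => dif_neg hE, fun F hF hd => ?_⟩, m_def⟩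
  have hU : MeasurableSet (⋃ i, F i) := MeasurableSet.iUnion hF
  have hs : ∀ s : Finset ℕ, MeasurableSet (⋃ j ∈ s, F j) :=
    fun s => s.measurableSet_biUnion fun j _ => hF j
  have hsub : ∀ s : Finset ℕ, (⋃ j ∈ s, F j) ⊆ ⋃ j, F j :=
    fun s => iUnion₂_subset fun j _ => subset_iUnion F j
  -- Countable additivity: the measure of the remaining tail tends to `0`, so, as `p < ∞`, the
  -- indicators of the finite unions converge in `L^p`, and `f` is continuous.
  have hlim : Tendsto (fun s : Finset ℕ => μ (symmDiff (⋃ j ∈ s, F j) (⋃ j, F j))) atTop (𝓝 0) := by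
    have h1 : ∀ s : Finset ℕ, μ (symmDiff (⋃ j ∈ s, F j) (⋃ j, F j)) =
        μ (⋃ j, F j) - ∑ j ∈ s, μ (F j) := fun s => by
      rw [symmDiff_of_le (hsub s), measure_sdiff (hsub s) (hs s).nullMeasurableSet
        (measure_ne_top _ _), measure_biUnion_finset (fun i _ j _ hij => hd hij) fun i _ => hF i]
    simp_rw [h1]
    rw [← tsub_self (μ (⋃ j, F j))]
    refine ENNReal.Tendsto.sub tendsto_const_nhds ?_ (Or.inl (measure_ne_top _ _))
    rw [measure_iUnion hd hF]
    exact ENNReal.summable.hasSum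
  have h2 := (f.continuous.tendsto _).comp
    (tendsto_indicatorConstLp_set (p := p) (c := (1 : ℝ)) (hs := hU)
      (hμs := measure_ne_top μ _) (ht := hs) (hμt := fun s => measure_ne_top μ _) hp hlim)
  rw [← m_def _ hU] at h2
  refine h2.congr fun s => ?_
  rw [Function.comp_apply, ← m_def _ (hs s), m_biUnion F hF hd]

/-- Radon-Nikodym density of a functional on `L^p`. -/
lemma exists_density (hp : p ≠ ∞) (f : StrongDual ℝ (Lp ℝ p μ)) :
    ∃ g : Ω → ℝ, Integrable g μ ∧ ∀ (E : Set Ω) (hE : MeasurableSet E),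
      f (indicatorConstLp p hE (measure_ne_top μ E) 1) = ∫ x in E, g x ∂μ := by
  obtain ⟨ν, hν⟩ := exists_signedMeasure hp f
  have hac : ν ≪ᵥ μ.toENNRealVectorMeasure := by
    intro E h0
    by_cases hE : MeasurableSet E
    · rw [Measure.toENNRealVectorMeasure_apply_measurable hE] at h0
      rw [hν E hE]
      convert map_zero f
      rw [Lp.eq_zero_iff_ae_eq_zero]
      refine indicatorConstLp_coeFn.trans ?_
      exact indicator_meas_zero h0
    · exact ν.not_measurable hE
  refine ⟨ν.rnDeriv μ, SignedMeasure.integrable_rnDeriv _ _, fun E hE => ?_⟩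
  rw [← hν E hE, ← withDensityᵥ_apply (SignedMeasure.integrable_rnDeriv _ _) hE,
    SignedMeasure.withDensityᵥ_rnDeriv_eq ν μ hac]

/-- Two functionals on `L^p` that agree on indicator functions are equal. -/
lemma strongDual_ext (hp : p ≠ ∞) {f g : StrongDual ℝ (Lp ℝ p μ)}
    (h : ∀ (E : Set Ω) (hE : MeasurableSet E),
      f (indicatorConstLp p hE (measure_ne_top μ E) 1) =
        g (indicatorConstLp p hE (measure_ne_top μ E) 1)) : f = g := by
  ext u
  induction u using Lp.induction hp with
  | indicatorConst c hs hμs =>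
    rw [Lp.simpleFunc.coe_indicatorConst]
    have h1 : indicatorConstLp p hs hμs.ne c = c • indicatorConstLp p hs hμs.ne (1 : ℝ) := by
      ext1
      filter_upwards [Lp.coeFn_smul c (indicatorConstLp p hs hμs.ne (1 : ℝ)),
        indicatorConstLp_coeFn (p := p) (hs := hs) (hμs := hμs.ne) (c := c),
        indicatorConstLp_coeFn (p := p) (hs := hs) (hμs := hμs.ne) (c := (1 : ℝ))] with x hx h2 h3
      rw [hx, Pi.smul_apply, h2, h3, ← indicator_const_smul_apply, smul_eq_mul, mul_one]
    rw [h1, map_smul, map_smul, h]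
  | add hf hg _ h1 h2 => rw [map_add, map_add, h1, h2]
  | isClosed => exact isClosed_eq f.continuous g.continuous

variable [ENNReal.HolderConjugate q p]

lemma scalarPairing_indicator (g : Lp ℝ q μ) {E : Set Ω} (hE : MeasurableSet E) :
    scalarPairing μ q p g (indicatorConstLp p hE (measure_ne_top μ E) 1) = ∫ x in E, g x ∂μ := by
  rw [ContinuousLinearMap.lpPairing_eq_integral, ← integral_indicator hE]
  refine integral_congr_ae ?_
  filter_upwards [indicatorConstLp_coeFn (p := p) (hs := hE) (hμs := measure_ne_top μ E)
    (c := (1 : ℝ))] with x hx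
  rw [hx, ContinuousLinearMap.mul_apply']
  by_cases hxE : x ∈ E <;> simp [hxE]

omit [IsFiniteMeasure μ] in
/-- The pairing recovers the norm of `L^q`. -/
lemma norm_le_norm_scalarPairing (hp : p ≠ ∞) (hq : q ≠ ∞) (g : Lp ℝ q μ) :
    ‖g‖ ≤ ‖scalarPairing μ q p g‖ := by
  have hq0 : 0 < q.toReal := ENNReal.toReal_pos (ENNReal.HolderConjugate.ne_zero q p) hq
  have hpq : q.toReal.HolderConjugate p.toReal :=
    ENNReal.HolderConjugate.toReal (p := q) (q := p)
      ((ENNReal.toReal_lt_toReal ENNReal.one_ne_top hq).2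
        ((ENNReal.HolderConjugate.lt_top_iff_one_lt p q).1 hp.lt_top))
  have hr : 0 < q.toReal - 1 := hpq.sub_one_pos
  have hqq : p * ENNReal.ofReal (q.toReal - 1) = q := by
    rw [← ENNReal.ofReal_toReal hp, ← ENNReal.ofReal_mul ENNReal.toReal_nonneg,
      mul_comm, hpq.sub_one_mul_conj, ENNReal.ofReal_toReal hq]
  -- The equality case of Hölder's inequality: `g w = |g|^q`, and `|w|^p = |g|^q` because `p (q - 1)
  -- = q`.
  let w : Ω → ℝ := fun x => SignType.sign (g x) * ‖g x‖ ^ (q.toReal - 1)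
  have hnw : ∀ x, ‖w x‖ = ‖‖g x‖ ^ (q.toReal - 1)‖ := fun x => by
    rcases lt_trichotomy (g x) 0 with h | h | h <;> simp [w, h, hr.ne']
  have hwm : AEStronglyMeasurable w μ := by
    have hg : AEMeasurable g μ := (Lp.aestronglyMeasurable g).aemeasurable
    have h1 : Measurable fun y : ℝ => ((SignType.sign y : SignType) : ℝ) := by
      have : (fun y : ℝ => ((SignType.sign y : SignType) : ℝ)) =
          fun y => if 0 < y then 1 else if y < 0 then -1 else 0 := by
        ext y
        rw [sign_apply]
        split_ifs <;> simp
      rw [this]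
      exact Measurable.ite measurableSet_Ioi measurable_const
        (Measurable.ite measurableSet_Iio measurable_const measurable_const)
    exact ((h1.comp_aemeasurable hg).mul (hg.norm.pow_const _)).aestronglyMeasurable
  have hw : eLpNorm w p μ = eLpNorm g q μ ^ (q.toReal - 1) := by
    rw [eLpNorm_congr_norm_ae (Eventually.of_forall hnw), eLpNorm_norm_rpow _ hr, hqq]
  have hwL : MemLp w p μ := ⟨hwm, by
    rw [hw]
    exact ENNReal.rpow_lt_top_of_nonneg hr.le (Lp.eLpNorm_ne_top g)⟩
  have hnorm : ‖hwL.toLp‖ = ‖g‖ ^ (q.toReal - 1) := by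
    rw [Lp.norm_toLp, hw, ← ENNReal.toReal_rpow, ← Lp.norm_def]
  have hval : scalarPairing μ q p g hwL.toLp = ‖g‖ ^ q.toReal := by
    rw [ContinuousLinearMap.lpPairing_eq_integral, Lp.norm_def,
      toReal_eLpNorm (Lp.aestronglyMeasurable g),
      lpNorm_eq_integral_norm_rpow_toReal (ENNReal.HolderConjugate.ne_zero q p) hq
        (Lp.aestronglyMeasurable g), ← Real.rpow_mul (by positivity), inv_mul_cancel₀ hq0.ne',
      Real.rpow_one]
    refine integral_congr_ae ?_
    filter_upwards [hwL.coeFn_toLp] with x hx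
    rw [hx, ContinuousLinearMap.mul_apply']
    simp only [w]
    rw [← mul_assoc, self_mul_sign, ← Real.norm_eq_abs]
    rcases eq_or_ne ‖g x‖ 0 with h | h
    · simp [h, hq0.ne']
    · rw [Real.rpow_sub_one h, mul_div_cancel₀ _ h]
  -- This reads `‖g‖^q ≤ ‖Λ‖ ‖g‖^(q-1)`, where `Λ` is the functional paired with `g`; a power of
  -- `‖g‖` cancels unless `g = 0`.
  have hle := (le_abs_self _).trans ((scalarPairing μ q p g).le_opNorm hwL.toLp)
  rw [hval, hnorm] at hle
  rcases eq_or_ne ‖g‖ 0 with h | h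
  · rw [h]; positivity
  · have hpos : 0 < ‖g‖ := lt_of_le_of_ne (norm_nonneg _) h.symm
    have h3 : ‖g‖ ^ q.toReal = ‖g‖ * ‖g‖ ^ (q.toReal - 1) := by
      rw [Real.rpow_sub_one h, mul_div_cancel₀ _ h]
    rw [h3] at hle
    exact le_of_mul_le_mul_right hle (by positivity)

/-- The density of a functional on `L^p` lies in `L^q`. -/
lemma memLp_density (hp : p ≠ ∞) (hq : q ≠ ∞) {f : StrongDual ℝ (Lp ℝ p μ)} {g : Ω → ℝ}
    (hg : Integrable g μ) (hfg : ∀ (E : Set Ω) (hE : MeasurableSet E),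
      f (indicatorConstLp p hE (measure_ne_top μ E) 1) = ∫ x in E, g x ∂μ) :
    MemLp g q μ := by
  wlog hgm : StronglyMeasurable g generalizing g
  · refine (this (hg.congr hg.1.ae_eq_mk) (fun E hE => ?_) hg.1.stronglyMeasurable_mk).ae_eq
      hg.1.ae_eq_mk.symm
    rw [hfg E hE]
    exact integral_congr_ae (ae_restrict_of_ae hg.1.ae_eq_mk)
  -- The truncations of `g` to these sets are bounded, hence in `L^q`. Each represents `f` composed
  -- with the contraction `M n`, multiplication by the indicator of `S n`. Their `L^q` norms are
  -- therefore at most `‖f‖`, and Fatou's lemma passes the bound to `g`.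
  let S : ℕ → Set Ω := fun n => {x | ‖g x‖ ≤ n}
  have hS : ∀ n, MeasurableSet (S n) := fun n => hgm.norm.measurable measurableSet_Iic
  have hbd : ∀ n, MemLp ((S n).indicator g) q μ := fun n => by
    refine MemLp.of_bound (hgm.indicator (hS n)).aestronglyMeasurable n (Eventually.of_forall ?_)
    intro x
    by_cases hx : x ∈ S n
    · rw [indicator_of_mem hx]; exact hx
    · rw [indicator_of_notMem hx]; simp
  let M : ℕ → Lp ℝ p μ →L[ℝ] Lp ℝ p μ := fun n =>
    (ContinuousLinearMap.mul ℝ ℝ).holderL μ ∞ p p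
      (indicatorConstLp ∞ (hS n) (measure_ne_top μ _) 1)
  have hM : ∀ n, ‖M n‖ ≤ 1 := fun n => by
    refine (M n).opNorm_le_bound zero_le_one fun u => ?_
    refine (ContinuousLinearMap.norm_holder_apply_apply_le _ _ _).trans ?_
    gcongr
    refine mul_le_one₀ (by simp) (norm_nonneg _) ?_
    refine norm_indicatorConstLp_le.trans ?_
    simp
  have hMi : ∀ n (E : Set Ω) (hE : MeasurableSet E),
      M n (indicatorConstLp p hE (measure_ne_top μ E) 1) =
        indicatorConstLp p (hE.inter (hS n)) (measure_ne_top μ _) 1 := fun n E hE => by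
    ext1
    refine (ContinuousLinearMap.coeFn_holder _ _ _).trans ?_
    filter_upwards [indicatorConstLp_coeFn (p := ∞) (hs := hS n) (hμs := measure_ne_top μ _)
        (c := (1 : ℝ)), indicatorConstLp_coeFn (p := p) (hs := hE) (hμs := measure_ne_top μ E)
        (c := (1 : ℝ)), indicatorConstLp_coeFn (p := p) (hs := hE.inter (hS n))
        (hμs := measure_ne_top μ _) (c := (1 : ℝ))] with x h1 h2 h3
    rw [h1, h2, h3, ContinuousLinearMap.mul_apply']
    by_cases hxE : x ∈ E <;> by_cases hxS : x ∈ S n <;> simp [hxE, hxS]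
  have hrep : ∀ n, scalarPairing μ q p (hbd n).toLp = f ∘L M n := fun n => by
    refine strongDual_ext hp fun E hE => ?_
    rw [scalarPairing_indicator, ContinuousLinearMap.comp_apply, hMi, hfg,
      ← setIntegral_indicator (hS n)]
    exact integral_congr_ae (ae_restrict_of_ae (hbd n).coeFn_toLp)
  have hle : ∀ n, eLpNorm ((S n).indicator g) q μ ≤ ENNReal.ofReal ‖f‖ := fun n => by
    rw [← ENNReal.ofReal_toReal (hbd n).2.ne, ← Lp.norm_toLp _ (hbd n)]
    refine ENNReal.ofReal_le_ofReal ((norm_le_norm_scalarPairing (p := p) hp hq _).trans ?_)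
    rw [hrep]
    exact (f.opNorm_comp_le (M n)).trans (mul_le_of_le_one_right (norm_nonneg _) (hM n))
  refine ⟨hg.1, lt_of_le_of_lt (Lp.eLpNorm_lim_le_liminf_eLpNorm
    (fun n => (hbd n).1) g (Eventually.of_forall fun x => ?_)) (lt_of_le_of_lt
      (liminf_le_of_le ?_ ?_) (ENNReal.ofReal_lt_top (r := ‖f‖)))⟩
  · obtain ⟨n, hn⟩ := exists_nat_ge ‖g x‖
    refine tendsto_const_nhds.congr' ?_
    filter_upwards [eventually_ge_atTop n] with k hk
    rw [indicator_of_mem]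
    exact hn.trans (by exact_mod_cast hk)
  · isBoundedDefault
  · intro c hc
    obtain ⟨n, hn⟩ := hc.exists
    exact hn.trans (hle n)

/-- **Riesz representation**: every functional on `L^p` is given by an element of `L^q`. -/
lemma scalarPairing_surjective (hp : p ≠ ∞) (hq : q ≠ ∞) :
    Function.Surjective (scalarPairing μ q p) := by
  intro f
  obtain ⟨g, hg, hfg⟩ := exists_density hp f
  have hgq : MemLp g q μ := memLp_density hp hq hg hfg
  refine ⟨hgq.toLp, strongDual_ext hp fun E hE => ?_⟩
  rw [scalarPairing_indicator, hfg E hE]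
  exact integral_congr_ae (ae_restrict_of_ae hgq.coeFn_toLp)

/-- Riesz is used twice: `L`, pulled back to `L^q`, is pairing with some `h` in `L^p`, and every
functional `f` is pairing with some `g` in `L^q`. Symmetry of the integral of `g h` gives `L f = f
h`. -/
lemma isReflexive_Lp_real (hp : p ≠ ∞) (hq : q ≠ ∞) : IsReflexive (Lp ℝ p μ) := by
  rw [isReflexive_iff]
  intro L
  obtain ⟨h, hh⟩ := scalarPairing_surjective (μ := μ) (p := q) (q := p) hq hp
    (L ∘L scalarPairing μ q p)
  refine ⟨h, fun f => ?_⟩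
  obtain ⟨g, rfl⟩ := scalarPairing_surjective (μ := μ) (p := p) (q := q) hp hq f
  have h1 := DFunLike.congr_fun hh g
  rw [ContinuousLinearMap.comp_apply] at h1
  rw [← h1, ContinuousLinearMap.lpPairing_eq_integral, ContinuousLinearMap.lpPairing_eq_integral]
  simp only [ContinuousLinearMap.mul_apply', mul_comm]

/-- `L^p` with values in a Euclidean space is reflexive for `1 < p < ∞`. -/
lemma isReflexive_Lp_euclidean {ι : Type*} [Fintype ι] (hp : p ≠ ∞) (hq : q ≠ ∞) :
    IsReflexive (Lp (EuclideanSpace ℝ ι) p μ) := by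
  classical
  -- `P` assembles a function from its coordinates and `Q` extracts them. Since `P` inverts `Q` on
  -- the left, `Q u` is a preimage of `u` with norm at most `‖Q‖ ‖u‖`.
  let P : (ι → Lp ℝ p μ) →L[ℝ] Lp (EuclideanSpace ℝ ι) p μ := ∑ i,
    ((ContinuousLinearMap.toSpanSingleton ℝ (EuclideanSpace.single i (1 : ℝ))).compLpL p μ) ∘L
      ContinuousLinearMap.proj i
  let Q : Lp (EuclideanSpace ℝ ι) p μ →L[ℝ] (ι → Lp ℝ p μ) :=
    ContinuousLinearMap.pi fun i => (EuclideanSpace.proj i : EuclideanSpace ℝ ι →L[ℝ] ℝ).compLpL p μ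
  refine (isReflexive_Lp_real (μ := μ) (q := q) hp hq).pi.of_surjective P ‖Q‖ fun u =>
    ⟨Q u, ?_, Q.le_opNorm u⟩
  have hP : P (Q u) = ∑ i,
      ((ContinuousLinearMap.toSpanSingleton ℝ (EuclideanSpace.single i (1 : ℝ))).compLpL p μ)
        (Q u i) := by
    simp [P]
  rw [hP]
  ext1
  have h1 : ∀ᵐ x ∂μ, ∀ i, Q u i x = u x i := by
    rw [ae_all_iff]
    exact fun i => ContinuousLinearMap.coeFn_compLpL _ _
  have h2 : ∀ᵐ x ∂μ, ∀ i,
      ((ContinuousLinearMap.toSpanSingleton ℝ (EuclideanSpace.single i (1 : ℝ))).compLpL p μ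
        (Q u i)) x = Q u i x • EuclideanSpace.single i (1 : ℝ) := by
    rw [ae_all_iff]
    exact fun i => ContinuousLinearMap.coeFn_compLpL _ _
  refine (Lp.coeFn_finsetSum _ _).trans ?_
  filter_upwards [h1, h2] with x hx1 hx2
  ext j
  simp [hx1, hx2, Pi.single_apply]

end Riesz

end TimeScale

theorem theorem31 (T : TopologicalSpace.Closeds ℝ) (a b : T) (hab : (a : ℝ) < b) (N : ℕ)
    (α p : ℝ) (hα : 0 < α) (hα' : α ≤ 1) [Fact (1 ≤ p)] (hp : 1 < p) :
    TimeScale.IsReflexive (TimeScale.RightSobolev T a b N α p) := by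
  -- As `1 < p`, the conjugate exponent is a finite real number, so Riesz representation also
  -- applies to the dual exponent.
  have hc : p.HolderConjugate p.conjExponent := Real.HolderConjugate.conjExponent hp
  have : ENNReal.HolderConjugate (ENNReal.ofReal p.conjExponent) (ENNReal.ofReal p) :=
    hc.symm.ennrealOfReal
  have : Fact (1 ≤ ENNReal.ofReal p.conjExponent) :=
    ⟨ENNReal.HolderConjugate.one_le _ (ENNReal.ofReal p)⟩
  exact TimeScale.isReflexive_rightSobolev (TimeScale.isReflexive_Lp_euclidean
    (q := ENNReal.ofReal p.conjExponent) ENNReal.ofReal_ne_top ENNReal.ofReal_ne_top)
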